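/- Fix $p$ and consider the linear model $y_i = X_i^T\beta^0+\varepsilon_i$, $i=1,\dots,n$, where $\beta^0\in\mathbb{R}^p$, $X_1,X_2,\dots$ are i.i.d. centered square-integrable random vectors in $\mathbb{R}^p$ with covariance matrix $C$, $\varepsilon_1,\varepsilon_2,\dots$ are i.i.d. centered random variables with finite variance $\sigma^2$, and the sequences $(X_i)$ and $(\varepsilon_i)$ are independent. Write $y=(y_1,\dots,y_n)^T$ and $X=(X_1,\dots,X_n)^T\in\mathbb{R}^{n\times p}$. For $\boldsymbol\lambda=(\lambda_1,\dots,\lambda_p)$ with $\lambda_1\ge\dots\ge\lambda_p\ge 0$ let $J_{\boldsymbol\lambda}(\beta)=\sum_{i=1}^p\lambda_i|\beta|_{(i)}$ be the SLOPE norm, where $|\beta|_{(1)}\ge\dots\ge|\beta|_{(p)}$ are the absolute values of the coordinates of $\beta$ in decreasing order, and let $J'_{\boldsymbol\lambda}(\beta^0;u)=\lim_{t\downarrow0}\big(J_{\boldsymbol\lambda}(\beta^0+tu)-J_{\boldsymbol\lambda}(\beta^0)\big)/t$ be its directional derivative. Let $\boldsymbol\lambda^n$, $n\ge 1$, be vectors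 with $\lambda^n_1\ge\dots\ge\lambda^n_p\ge0$, and let $\hat\beta_n$ be any (measurable) minimizer of $\beta\mapsto\frac12\|y-X\beta\|_2^2+J_{\boldsymbol\lambda^n}(\beta)$ over $\mathbb{R}^p$. Suppose $\boldsymbol\lambda^n/\sqrt n\to\boldsymbol\lambda$ (so that $\lambda_1\ge\dots\ge\lambda_p\ge0$) and that $C$ is positive definite. Let $W\sim\mathcal N(0,\sigma^2C)$. Then the function $$V(u)=\tfrac12u^TCu-u^TW+J'_{\boldsymbol\lambda}(\beta^0;u)$$ has a unique minimizer $\hat u=\operatorname{argmin}_uV(u)$ for every value of $W$, and $\sqrt n(\hat\beta_n-\beta^0)$ converges in distribution to $\hat u$. Moreover, for every $u\in\mathbb{R}^p$ there is a permutation $\pi$ of $\{1,\dots,p\}$ which sorts $|\beta^0+u/\sqrt n|$ for all sufficiently large $n$, i.e. there is $M>0$ such that for all $n\ge M$ $$|\beta^0+u/\sqrt n|_{\pi^{-1}(1)}\ge\dots\ge|\beta^0+u/\sqrt n|_{\pi^{-1}(p)}$$ (here $|v|_j=|v_j|$); the directional derivative $J'_{\boldsymbol\lambda}(\beta^0;u)$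 exists, and for every such $\pi$ $$J'_{\boldsymbol\lambda}(\beta^0;u)=\sum_{i=1}^p\lambda_{\pi(i)}\Big[u_i\,\mathrm{sgn}(\beta^0_i)\,\mathbb{1}[\beta^0_i\ne0]+|u_i|\,\mathbb{1}[\beta^0_i=0]\Big].$$ -/

import Mathlib

open MeasureTheory ProbabilityTheory Filter Topology
open scoped Matrix

namespace Slope

noncomputable section

/-- The absolute values of the coordinates of `b`, in decreasing order:
`sortedAbs b 0 ≥ sortedAbs b 1 ≥ …`. -/
def sortedAbs {p : ℕ} (b : EuclideanSpace ℝ (Fin p)) (i : Fin p) : ℝ :=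
  |b (Tuple.sort (fun j => -|b j|) i)|

theorem sortedAbs_antitone {p : ℕ} (b : EuclideanSpace ℝ (Fin p)) : Antitone (sortedAbs b) := by
  intro i j hij
  have h := Tuple.monotone_sort (fun j => -|b j|) hij
  exact neg_le_neg_iff.mp h

/-- A penalty vector: `l 0 ≥ l 1 ≥ … ≥ 0`. -/
def IsPenalty {p : ℕ} (l : Fin p → ℝ) : Prop :=
  Antitone l ∧ ∀ i, 0 ≤ l i

/-- The SLOPE (sorted `ℓ¹`) norm with penalty vector `l`. -/
def slopeNorm {p : ℕ} (l : Fin p → ℝ) (b : EuclideanSpace ℝ (Fin p)) : ℝ :=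
  ∑ i, l i * sortedAbs b i

/-- The design matrix whose rows are the first `n` terms of a sequence of vectors. -/
def designMatrix {p : ℕ} (x : ℕ → EuclideanSpace ℝ (Fin p)) (n : ℕ) :
    Matrix (Fin n) (Fin p) ℝ :=
  Matrix.of fun i j => x i j

/-- The response `y = X b₀ + e` of the linear model with `n` observations. -/
def response {p : ℕ} (x : ℕ → EuclideanSpace ℝ (Fin p)) (e : ℕ → ℝ)
    (b₀ : EuclideanSpace ℝ (Fin p)) (n : ℕ) : Fin n → ℝ :=
  fun i => (designMatrix x n *ᵥ ⇑b₀) i + e i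

/-- The SLOPE objective `½ ‖y - X b‖₂² + J_l(b)`. -/
def slopeObjective {n p : ℕ} (A : Matrix (Fin n) (Fin p) ℝ) (y : Fin n → ℝ) (l : Fin p → ℝ)
    (b : EuclideanSpace ℝ (Fin p)) : ℝ :=
  1 / 2 * ‖WithLp.toLp 2 (y - A *ᵥ ⇑b)‖ ^ 2 + slopeNorm l b

/-- The function `t ↦ f (b + t u)` has right derivative `d` at `t = 0`. -/
def HasDirDeriv {p : ℕ} (f : EuclideanSpace ℝ (Fin p) → ℝ)
    (b u : EuclideanSpace ℝ (Fin p)) (d : ℝ) : Prop :=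
  Tendsto (fun t : ℝ => (f (b + t • u) - f b) / t) (𝓝[>] 0) (𝓝 d)

/-- The (one-sided) directional derivative `f'(b; u) = lim_{t ↓ 0} (f (b + t u) - f b) / t`. -/
def dirDeriv {p : ℕ} (f : EuclideanSpace ℝ (Fin p) → ℝ)
    (b u : EuclideanSpace ℝ (Fin p)) : ℝ :=
  derivWithin (fun t : ℝ => f (b + t • u)) (Set.Ici 0) 0

theorem HasDirDeriv.dirDeriv_eq {p : ℕ} {f : EuclideanSpace ℝ (Fin p) → ℝ}
    {b u : EuclideanSpace ℝ (Fin p)} {d : ℝ} (h : HasDirDeriv f b u d) : dirDeriv f b u = d := by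
  refine HasDerivWithinAt.derivWithin ?_ (uniqueDiffOn_Ici (0 : ℝ) 0 Set.self_mem_Ici)
  rw [hasDerivWithinAt_iff_tendsto_slope, Set.Ici_sdiff_left]
  refine h.congr fun t => ?_
  simp [slope_def_field]

/-- The limiting objective `V(u) = ½ uᵀ C u - uᵀ w + J'_l(b₀; u)`. -/
def limitObjective {p : ℕ} (C : Matrix (Fin p) (Fin p) ℝ) (l : Fin p → ℝ)
    (b₀ w u : EuclideanSpace ℝ (Fin p)) : ℝ :=
  1 / 2 * (⇑u ⬝ᵥ C *ᵥ ⇑u) - ⇑u ⬝ᵥ ⇑w + dirDeriv (slopeNorm l) b₀ u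

/-- `π` sorts `|b₀ + u / √n|` for all sufficiently large `n`: position `j` of the decreasing
arrangement is occupied by the coordinate `π⁻¹ j`. -/
def EventuallySorts {p : ℕ} (π : Equiv.Perm (Fin p)) (b₀ u : EuclideanSpace ℝ (Fin p)) : Prop :=
  ∃ M : ℕ, 0 < M ∧ ∀ n : ℕ, M ≤ n →
    Antitone fun j : Fin p => |(b₀ + (√(n : ℝ))⁻¹ • u) (π.symm j)|

end

end Slope

/-! Substitute `β = β₀ + u/√n`. Up to a constant independent of `u`, the SLOPE objective becomes `½
uᵀ Aₙ u - uᵀ Yₙ + gₙ(u)`, where `Aₙ` is the empirical Gram matrix, `Yₙ` the normalized score and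
`gₙ` the increment of the penalty; hence `√n (βhat - β₀)` minimizes this function
(`slopeObjective_add_smul`). Here `Aₙ → C` almost surely by the law of large numbers, and `Yₙ → W`
in law by the central limit theorem.

The SLOPE norm is piecewise linear: on a ball around `β₀` it is exactly affine along rays, with a
slope that is linear in the penalty vector (`exists_radius_slopeNorm`). So `gₙ` converges to the
directional derivative uniformly on bounded sets. The same fact yields the explicit formula for the
derivative.

The passage to minimizers is deterministic. The limiting function is strongly convex, so its
minimizer `umin w` is Lipschitz in the linear term `w`, and minimizers of nearby convex functions
stay close to it, uniformly over bounded `w` (`exists_eventually_norm_sub_lt`). Since the `Yₙ` are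
tight, `√n (βhat - β₀) - umin Yₙ → 0` in probability, and the continuous mapping and Slutsky
theorems finish the proof. -/

namespace Slope

/-! ### Local structure and convexity of the SLOPE norm -/

section

/-- The right derivative of `t ↦ |bᵢ + t uᵢ|` at `t = 0`. -/
noncomputable def absDirDeriv {p : ℕ} (b u : EuclideanSpace ℝ (Fin p)) (i : Fin p) : ℝ :=
  u i * Real.sign (b i) * (if b i ≠ 0 then 1 else 0) + |u i| * (if b i = 0 then 1 else 0)

variable {p : ℕ}

theorem abs_absDirDeriv_le (b u : EuclideanSpace ℝ (Fin p)) (i : Fin p) :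
    |absDirDeriv b u i| ≤ ‖u‖ := by
  have h : |u i| ≤ ‖u‖ := PiLp.norm_apply_le u i
  unfold absDirDeriv
  rcases lt_trichotomy (b i) 0 with hb | hb | hb
  · simpa [hb.ne, Real.sign_of_neg hb] using h
  · simpa [hb] using h
  · simpa [hb.ne', Real.sign_of_pos hb] using h

/-- A displacement of size at most `|b i|` cannot reverse the sign of a nonzero coordinate. -/
theorem abs_add_smul_apply {b u : EuclideanSpace ℝ (Fin p)} {i : Fin p} {t : ℝ} (ht : 0 ≤ t)
    (h : b i ≠ 0 → t * ‖u‖ ≤ |b i|) :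
    |(b + t • u) i| = |b i| + t * absDirDeriv b u i := by
  have hu := abs_le.mp (PiLp.norm_apply_le u i : |u i| ≤ ‖u‖)
  have h1 := mul_le_mul_of_nonneg_left hu.1 ht
  have h2 := mul_le_mul_of_nonneg_left hu.2 ht
  simp only [PiLp.add_apply, PiLp.smul_apply, smul_eq_mul]
  unfold absDirDeriv
  rcases lt_trichotomy (b i) 0 with hb | hb | hb
  · have h3 := h hb.ne
    rw [abs_of_neg hb] at h3
    rw [abs_of_neg hb, abs_of_nonpos (by linarith)]
    simp [hb.ne, Real.sign_of_neg hb]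
    ring
  · simp [hb, abs_mul, abs_of_nonneg ht]
  · have h3 := h hb.ne'
    rw [abs_of_pos hb] at h3
    rw [abs_of_pos hb, abs_of_nonneg (by linarith)]
    simp [hb.ne', Real.sign_of_pos hb]

/-- Ties make the sorting permutation ambiguous, but the sorted sequence of values is unique. -/
theorem slopeNorm_eq_of_antitone (l : Fin p → ℝ) {b : EuclideanSpace ℝ (Fin p)}
    {s : Equiv.Perm (Fin p)} (hs : Antitone fun j => |b (s j)|) :
    slopeNorm l b = ∑ j, l j * |b (s j)| := by
  have h : (fun j => -|b j|) ∘ s = (fun j => -|b j|) ∘ Tuple.sort (fun j => -|b j|) :=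
    Tuple.comp_sort_eq_comp_iff_monotone.mpr fun i j hij => neg_le_neg (hs hij)
  refine Finset.sum_congr rfl fun j _ => ?_
  have hj := congrFun h j
  simp only [Function.comp_apply, neg_inj] at hj
  rw [sortedAbs, hj]

/-- Rearrangement inequality. It exhibits the SLOPE norm as a maximum over permutations, which is
the source of its convexity. -/
theorem sum_mul_abs_perm_le_slopeNorm {l : Fin p → ℝ} (hl : Antitone l)
    (b : EuclideanSpace ℝ (Fin p)) (s : Equiv.Perm (Fin p)) :
    ∑ j, l j * |b (s j)| ≤ slopeNorm l b := by
  have h : Monovary l (sortedAbs b) := hl.monovary (sortedAbs_antitone b)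
  have h1 := h.sum_mul_comp_perm_le_sum_mul (σ := s.trans (Tuple.sort fun j => -|b j|).symm)
  simpa [slopeNorm, sortedAbs] using h1

theorem convexOn_slopeNorm {l : Fin p → ℝ} (hl : IsPenalty l) :
    ConvexOn ℝ Set.univ (slopeNorm l) := by
  refine ⟨convex_univ, fun x _ y _ a c ha hc _ => ?_⟩
  have hx := sum_mul_abs_perm_le_slopeNorm hl.1 x (Tuple.sort fun j => -|(a • x + c • y) j|)
  have hy := sum_mul_abs_perm_le_slopeNorm hl.1 y (Tuple.sort fun j => -|(a • x + c • y) j|)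
  refine le_trans ?_ (add_le_add (mul_le_mul_of_nonneg_left hx ha)
    (mul_le_mul_of_nonneg_left hy hc))
  rw [Finset.mul_sum, Finset.mul_sum, ← Finset.sum_add_distrib, slopeNorm]
  refine Finset.sum_le_sum fun j _ => ?_
  rw [sortedAbs]
  set k := Tuple.sort (fun j => -|(a • x + c • y) j|) j
  have h : |(a • x + c • y) k| ≤ a * |x k| + c * |y k| := by
    refine (abs_add_le _ _).trans (le_of_eq ?_)
    simp [abs_mul, abs_of_nonneg ha, abs_of_nonneg hc]
  nlinarith [mul_le_mul_of_nonneg_left h (hl.2 j)]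

/-- Along every direction `u`, a single permutation sorts `|b + t u|` for all small `t ≥ 0`, and
the coordinates of `|b + t u|` are affine in `t`; the range of `t` depends only on `‖u‖`. -/
theorem exists_radius_sorting (b : EuclideanSpace ℝ (Fin p)) :
    ∃ r > 0, ∀ u : EuclideanSpace ℝ (Fin p), ∃ s : Equiv.Perm (Fin p), ∀ t : ℝ, 0 ≤ t →
      t * ‖u‖ ≤ r → (Antitone fun j => |(b + t • u) (s j)|) ∧
        ∀ i, |(b + t • u) i| = |b i| + t * absDirDeriv b u i := by
  have h1 : ∀ᶠ r in 𝓝[>] (0 : ℝ), (∀ i, b i ≠ 0 → r ≤ |b i|) := by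
    rw [eventually_all]
    intro i
    by_cases hi : b i = 0
    · simp [hi]
    · filter_upwards [nhdsWithin_le_nhds (eventually_le_nhds (abs_pos.mpr hi))] with r hr _ using hr
  -- No coordinate moves by more than `r`, so with `r` at most half of each gap, strictly ordered
  -- absolute values cannot cross.
  have h2 : ∀ᶠ r in 𝓝[>] (0 : ℝ), (∀ i j, |b i| < |b j| → r ≤ (|b j| - |b i|) / 2) := by
    simp_rw [eventually_all]
    intro i j hij
    have : 0 < (|b j| - |b i|) / 2 := by linarith
    filter_upwards [nhdsWithin_le_nhds (eventually_le_nhds this)] with r hr using hr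
  obtain ⟨r, ⟨hr1, hr2⟩, hr⟩ := ((h1.and h2).and self_mem_nhdsWithin).exists
  refine ⟨r, hr, fun u => ?_⟩
  -- Sorting decreasingly by `|b i|` and breaking ties by the rate of change gives an order that is
  -- correct for all small `t` at once.
  let key : Fin p → ℝ ×ₗ ℝ := fun i => toLex (-|b i|, -absDirDeriv b u i)
  refine ⟨Tuple.sort key, fun t ht htu => ?_⟩
  have h3 : ∀ i, |(b + t • u) i| = |b i| + t * absDirDeriv b u i :=
    fun i => abs_add_smul_apply ht fun hi => htu.trans (hr1 i hi)
  refine ⟨fun i j hij => ?_, h3⟩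
  have h4 : key (Tuple.sort key i) ≤ key (Tuple.sort key j) := Tuple.monotone_sort key hij
  simp only [h3]
  rcases Prod.Lex.toLex_le_toLex.mp h4 with h | ⟨h, h'⟩
  · have h5 := hr2 _ _ (neg_lt_neg_iff.mp h)
    have h6 := abs_le.mp (abs_absDirDeriv_le b u (Tuple.sort key i))
    have h7 := abs_le.mp (abs_absDirDeriv_le b u (Tuple.sort key j))
    have h8 := mul_le_mul_of_nonneg_left h6.1 ht
    have h9 := mul_le_mul_of_nonneg_left h7.2 ht
    linarith
  · have h5 := mul_le_mul_of_nonneg_left h' ht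
    simp only [neg_inj] at h
    rw [h]
    linarith

theorem slopeNorm_add_smul_of_sorting {b u : EuclideanSpace ℝ (Fin p)} {s : Equiv.Perm (Fin p)}
    {r : ℝ} (hr : 0 < r)
    (hs : ∀ t : ℝ, 0 ≤ t → t * ‖u‖ ≤ r → (Antitone fun j => |(b + t • u) (s j)|) ∧
        ∀ i, |(b + t • u) i| = |b i| + t * absDirDeriv b u i)
    (l : Fin p → ℝ) {t : ℝ} (ht : 0 ≤ t) (htu : t * ‖u‖ ≤ r) :
    slopeNorm l (b + t • u) = slopeNorm l b + t * ∑ j, l j * absDirDeriv b u (s j) := by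
  have h0 := (hs 0 le_rfl (by simpa using hr.le)).1
  rw [zero_smul, add_zero] at h0
  rw [slopeNorm_eq_of_antitone l (hs t ht htu).1, slopeNorm_eq_of_antitone l h0, Finset.mul_sum,
    ← Finset.sum_add_distrib]
  refine Finset.sum_congr rfl fun j _ => ?_
  rw [(hs t ht htu).2]
  ring

theorem hasDirDeriv_of_eq_add_mul {f : EuclideanSpace ℝ (Fin p) → ℝ}
    {b u : EuclideanSpace ℝ (Fin p)} {d r : ℝ} (hr : 0 < r)
    (h : ∀ t : ℝ, 0 ≤ t → t * ‖u‖ ≤ r → f (b + t • u) = f b + t * d) : HasDirDeriv f b u d := by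
  refine tendsto_const_nhds.congr' ?_
  have h1 : Tendsto (fun t : ℝ => t * ‖u‖) (𝓝[>] 0) (𝓝 0) := by
    have : Continuous fun t : ℝ => t * ‖u‖ := by fun_prop
    simpa using (this.tendsto 0).mono_left nhdsWithin_le_nhds
  filter_upwards [h1.eventually_le_const hr, self_mem_nhdsWithin] with t ht ht0
  have ht0' : (0 : ℝ) < t := ht0
  rw [h t ht0'.le ht]
  field_simp
  ring

/-- Near `b` the SLOPE norm is exactly affine along rays, and its slope is an explicit linear
function of the penalty vector. -/
theorem exists_radius_slopeNorm (b : EuclideanSpace ℝ (Fin p)) :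
    ∃ r > 0, ∀ u : EuclideanSpace ℝ (Fin p), ∃ s : Equiv.Perm (Fin p), ∀ l : Fin p → ℝ,
      HasDirDeriv (slopeNorm l) b u (dirDeriv (slopeNorm l) b u) ∧
      dirDeriv (slopeNorm l) b u = ∑ j, l j * absDirDeriv b u (s j) ∧
      ∀ t : ℝ, 0 ≤ t → t * ‖u‖ ≤ r →
        slopeNorm l (b + t • u) = slopeNorm l b + t * dirDeriv (slopeNorm l) b u := by
  obtain ⟨r, hr, h⟩ := exists_radius_sorting b
  refine ⟨r, hr, fun u => ?_⟩
  obtain ⟨s, hs⟩ := h u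
  refine ⟨s, fun l => ?_⟩
  have h1 := fun (t : ℝ) (ht : 0 ≤ t) htu => slopeNorm_add_smul_of_sorting hr hs l ht htu
  have h2 := hasDirDeriv_of_eq_add_mul hr h1
  rw [h2.dirDeriv_eq]
  exact ⟨h2, rfl, h1⟩

theorem hasDirDeriv_slopeNorm (l : Fin p → ℝ) (b u : EuclideanSpace ℝ (Fin p)) :
    HasDirDeriv (slopeNorm l) b u (dirDeriv (slopeNorm l) b u) := by
  obtain ⟨r, -, h⟩ := exists_radius_slopeNorm b
  obtain ⟨s, hs⟩ := h u
  exact (hs l).1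

theorem abs_dirDeriv_slopeNorm_le (l : Fin p → ℝ) (b u : EuclideanSpace ℝ (Fin p)) :
    |dirDeriv (slopeNorm l) b u| ≤ (∑ j, |l j|) * ‖u‖ := by
  obtain ⟨r, -, h⟩ := exists_radius_slopeNorm b
  obtain ⟨s, hs⟩ := h u
  rw [(hs l).2.1, Finset.sum_mul]
  refine (Finset.abs_sum_le_sum_abs _ _).trans (Finset.sum_le_sum fun j _ => ?_)
  rw [abs_mul]
  exact mul_le_mul_of_nonneg_left (abs_absDirDeriv_le b u _) (abs_nonneg _)

/-- Each difference quotient is convex in the direction, and convexity survives pointwise limits. -/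
theorem convexOn_dirDeriv_slopeNorm {l : Fin p → ℝ} (hl : IsPenalty l)
    (b : EuclideanSpace ℝ (Fin p)) : ConvexOn ℝ Set.univ (dirDeriv (slopeNorm l) b) := by
  refine ⟨convex_univ, fun x _ y _ a c ha hc hac => ?_⟩
  refine le_of_tendsto_of_tendsto (hasDirDeriv_slopeNorm l b (a • x + c • y))
    (((hasDirDeriv_slopeNorm l b x).const_mul a).add ((hasDirDeriv_slopeNorm l b y).const_mul c)) ?_
  filter_upwards [self_mem_nhdsWithin] with t ht
  have ht0 : (0 : ℝ) < t := ht
  have h := (convexOn_slopeNorm hl).2 (Set.mem_univ (b + t • x)) (Set.mem_univ (b + t • y))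
    ha hc hac
  have h1 : a • (b + t • x) + c • (b + t • y) = b + t • (a • x + c • y) := by
    have : b = (a + c) • b := by rw [hac, one_smul]
    conv_rhs => rw [this]
    module
  rw [h1] at h
  rw [mul_div_assoc', mul_div_assoc', ← add_div, div_le_div_iff_of_pos_right ht0]
  simp only [smul_eq_mul] at h
  have h2 : slopeNorm l b = a * slopeNorm l b + c * slopeNorm l b := by rw [← add_mul, hac, one_mul]
  linarith

theorem tendsto_inv_sqrt_natCast : Tendsto (fun n : ℕ => (√(n : ℝ))⁻¹) atTop (𝓝 0) :=
  tendsto_inv_atTop_zero.comp (Real.tendsto_sqrt_atTop.comp tendsto_natCast_atTop_atTop)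

theorem eventually_inv_sqrt_mul_le (c : ℝ) {r : ℝ} (hr : 0 < r) :
    ∀ᶠ n : ℕ in atTop, (√(n : ℝ))⁻¹ * c ≤ r := by
  have h := tendsto_inv_sqrt_natCast.mul_const c
  rw [zero_mul] at h
  exact h.eventually_le_const hr

theorem exists_eventuallySorts (b u : EuclideanSpace ℝ (Fin p)) : ∃ π, EventuallySorts π b u := by
  obtain ⟨r, hr, h⟩ := exists_radius_sorting b
  obtain ⟨s, hs⟩ := h u
  obtain ⟨N, hN⟩ := eventually_atTop.mp (eventually_inv_sqrt_mul_le ‖u‖ hr)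
  exact ⟨s.symm, N + 1, N.succ_pos, fun n hn =>
    (hs _ (by positivity) (hN n (by omega))).1⟩

/-- For large `n` the norm at `b + u/√n` is given by two affine expressions in `1/√n`, one from the
directional derivative and one from sorting by `π`. Agreement at two values of `n` forces equal
slopes. -/
theorem dirDeriv_slopeNorm_eq_of_eventuallySorts (l : Fin p → ℝ) {b u : EuclideanSpace ℝ (Fin p)}
    {π : Equiv.Perm (Fin p)} (hπ : EventuallySorts π b u) :
    dirDeriv (slopeNorm l) b u = ∑ i, l (π i) * absDirDeriv b u i := by
  obtain ⟨r, hr, h⟩ := exists_radius_sorting b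
  obtain ⟨s, hs⟩ := h u
  obtain ⟨r', hr', h'⟩ := exists_radius_slopeNorm b
  obtain ⟨s', hs'⟩ := h' u
  obtain ⟨M, -, hM⟩ := hπ
  have h1 : ∀ᶠ n : ℕ in atTop, slopeNorm l b + (√(n : ℝ))⁻¹ * dirDeriv (slopeNorm l) b u =
      ∑ i, l (π i) * |b i| + (√(n : ℝ))⁻¹ * ∑ i, l (π i) * absDirDeriv b u i := by
    filter_upwards [eventually_inv_sqrt_mul_le ‖u‖ hr, eventually_inv_sqrt_mul_le ‖u‖ hr',
      eventually_ge_atTop M] with n hn hn' hnM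
    rw [← (hs' l).2.2 _ (by positivity) hn', slopeNorm_eq_of_antitone l (hM n hnM),
      ← Equiv.sum_comp π, Finset.mul_sum, ← Finset.sum_add_distrib]
    refine Finset.sum_congr rfl fun i _ => ?_
    rw [Equiv.symm_apply_apply, (hs _ (by positivity) hn).2]
    ring
  obtain ⟨N, hN⟩ := eventually_atTop.mp h1
  have e1 := hN (N + 1) (by omega)
  -- The factor `4` halves `1/√n`, so the two equations can be subtracted without further square
  -- roots.
  have e2 := hN (4 * (N + 1)) (by omega)
  have h4 : √((4 * (N + 1) : ℕ) : ℝ) = 2 * √((N + 1 : ℕ) : ℝ) := by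
    rw [Nat.cast_mul, Real.sqrt_mul (by positivity)]
    congr 1
    rw [show ((4 : ℕ) : ℝ) = 2 ^ 2 by norm_num, Real.sqrt_sq (by norm_num)]
  rw [h4, mul_inv] at e2
  have h5 : 0 < (√((N + 1 : ℕ) : ℝ))⁻¹ := by positivity
  refine mul_left_cancel₀ h5.ne' ?_
  linarith

end

/-! ### Penalized quadratic functions: growth, uniqueness and stability of minimizers -/

section

variable {p : ℕ}

/-- The penalized quadratic function `½ uᵀ A u - uᵀ w + f(u)`. -/
noncomputable def quadObjective (A : Matrix (Fin p) (Fin p) ℝ) (f : EuclideanSpace ℝ (Fin p) → ℝ)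
    (w u : EuclideanSpace ℝ (Fin p)) : ℝ :=
  1 / 2 * (⇑u ⬝ᵥ A *ᵥ ⇑u) - ⇑u ⬝ᵥ ⇑w + f u

theorem dotProduct_eq_inner (u w : EuclideanSpace ℝ (Fin p)) : ⇑u ⬝ᵥ ⇑w = inner ℝ u w := by
  simp [PiLp.inner_apply, dotProduct, mul_comm]

theorem dotProduct_le_norm_mul_norm (u w : EuclideanSpace ℝ (Fin p)) :
    ⇑u ⬝ᵥ ⇑w ≤ ‖u‖ * ‖w‖ := by
  rw [dotProduct_eq_inner]
  exact real_inner_le_norm u w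

theorem abs_quadForm_sub_le (A C : Matrix (Fin p) (Fin p) ℝ) (u : EuclideanSpace ℝ (Fin p)) :
    |⇑u ⬝ᵥ A *ᵥ ⇑u - ⇑u ⬝ᵥ C *ᵥ ⇑u| ≤ (∑ i, ∑ j, |A i j - C i j|) * ‖u‖ ^ 2 := by
  have h : ⇑u ⬝ᵥ A *ᵥ ⇑u - ⇑u ⬝ᵥ C *ᵥ ⇑u = ∑ i, ∑ j, u i * ((A i j - C i j) * u j) := by
    rw [← dotProduct_sub, ← Matrix.sub_mulVec]
    simp [dotProduct, Matrix.mulVec, Finset.mul_sum]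
  rw [h, Finset.sum_mul]
  refine (Finset.abs_sum_le_sum_abs _ _).trans (Finset.sum_le_sum fun i _ => ?_)
  rw [Finset.sum_mul]
  refine (Finset.abs_sum_le_sum_abs _ _).trans (Finset.sum_le_sum fun j _ => ?_)
  have hi : |u i| ≤ ‖u‖ := PiLp.norm_apply_le u i
  have hj : |u j| ≤ ‖u‖ := PiLp.norm_apply_le u j
  rw [abs_mul, abs_mul]
  calc |u i| * (|A i j - C i j| * |u j|) = |A i j - C i j| * (|u i| * |u j|) := by ring
    _ ≤ |A i j - C i j| * (‖u‖ * ‖u‖) := by gcongr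
    _ = _ := by ring

theorem exists_pos_le_quadForm {C : Matrix (Fin p) (Fin p) ℝ} (hC : C.PosDef) :
    ∃ m > 0, ∀ u : EuclideanSpace ℝ (Fin p), m * ‖u‖ ^ 2 ≤ ⇑u ⬝ᵥ C *ᵥ ⇑u := by
  have hpos : ∀ u : EuclideanSpace ℝ (Fin p), u ≠ 0 → 0 < ⇑u ⬝ᵥ C *ᵥ ⇑u := fun u hu => by
    have := hC.dotProduct_mulVec_pos (x := ⇑u) (by simpa using hu)
    simpa using this
  have hcont : Continuous fun u : EuclideanSpace ℝ (Fin p) => ⇑u ⬝ᵥ C *ᵥ ⇑u := by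
    simp only [dotProduct, Matrix.mulVec]
    fun_prop
  -- The unit sphere is empty exactly when `p = 0`; otherwise `m` is the minimum of the form on it.
  rcases (Metric.sphere (0 : EuclideanSpace ℝ (Fin p)) 1).eq_empty_or_nonempty with h0 | h0
  · refine ⟨1, one_pos, fun u => ?_⟩
    have hu : u = 0 := by
      by_contra hu
      have : (‖u‖⁻¹ • u) ∈ Metric.sphere (0 : EuclideanSpace ℝ (Fin p)) 1 := by
        simp [norm_smul, hu]
      rw [h0] at this
      exact this
    simp [hu]
  · obtain ⟨z, hz, hmin⟩ := (isCompact_sphere _ _).exists_isMinOn h0 hcont.continuousOn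
    have hz0 : z ≠ 0 := by
      rintro rfl
      simp at hz
    refine ⟨_, hpos z hz0, fun u => ?_⟩
    by_cases hu : u = 0
    · simp [hu]
    have hu' : (0 : ℝ) < ‖u‖ := norm_pos_iff.mpr hu
    have h1 := hmin (show (‖u‖⁻¹ • u) ∈ Metric.sphere (0 : EuclideanSpace ℝ (Fin p)) 1 by
      simp [norm_smul, hu])
    simp only [Set.mem_ofPred_eq, WithLp.ofLp_smul, Matrix.mulVec_smul, dotProduct_smul,
      smul_dotProduct, smul_eq_mul] at h1
    have h2 := mul_le_mul_of_nonneg_right h1 (sq_nonneg ‖u‖)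
    refine h2.trans (le_of_eq ?_)
    field_simp

section

variable {A C : Matrix (Fin p) (Fin p) ℝ} {f g : EuclideanSpace ℝ (Fin p) → ℝ}
  {m : ℝ} {w u v : EuclideanSpace ℝ (Fin p)}

/-- The quadratic part satisfies this with equality; only `f` contributes an inequality. -/
theorem quadObjective_add_smul_le (A : Matrix (Fin p) (Fin p) ℝ) (hf : ConvexOn ℝ Set.univ f)
    (w u v : EuclideanSpace ℝ (Fin p)) {s : ℝ} (hs0 : 0 ≤ s) (hs1 : s ≤ 1) :
    quadObjective A f w (u + s • (v - u)) ≤ (1 - s) * quadObjective A f w u +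
      s * quadObjective A f w v - 1 / 2 * s * (1 - s) * (⇑(v - u) ⬝ᵥ A *ᵥ ⇑(v - u)) := by
  have h := hf.2 (Set.mem_univ u) (Set.mem_univ v) (sub_nonneg.mpr hs1) hs0 (by ring)
  rw [show (1 - s) • u + s • v = u + s • (v - u) by module] at h
  simp only [smul_eq_mul] at h
  have h2 : 1 / 2 * (⇑(u + s • (v - u)) ⬝ᵥ A *ᵥ ⇑(u + s • (v - u))) - ⇑(u + s • (v - u)) ⬝ᵥ ⇑w =
      (1 - s) * (1 / 2 * (⇑u ⬝ᵥ A *ᵥ ⇑u) - ⇑u ⬝ᵥ ⇑w) +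
      s * (1 / 2 * (⇑v ⬝ᵥ A *ᵥ ⇑v) - ⇑v ⬝ᵥ ⇑w) -
      1 / 2 * s * (1 - s) * (⇑(v - u) ⬝ᵥ A *ᵥ ⇑(v - u)) := by
    simp only [WithLp.ofLp_add, WithLp.ofLp_smul, WithLp.ofLp_sub, Matrix.mulVec_add,
      Matrix.mulVec_sub, Matrix.mulVec_smul, dotProduct_add, dotProduct_sub, dotProduct_smul,
      add_dotProduct, sub_dotProduct, smul_dotProduct, smul_eq_mul]
    ring
  unfold quadObjective
  linarith

/-- Compare the minimum with the value at `u + s(v - u)`, divide by `s` and let `s ↓ 0`. -/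
theorem quadObjective_add_le_of_isMinOn (hf : ConvexOn ℝ Set.univ f)
    (hu : IsMinOn (quadObjective A f w) Set.univ u) (v : EuclideanSpace ℝ (Fin p)) :
    quadObjective A f w u + 1 / 2 * (⇑(v - u) ⬝ᵥ A *ᵥ ⇑(v - u)) ≤ quadObjective A f w v := by
  set q := ⇑(v - u) ⬝ᵥ A *ᵥ ⇑(v - u) with hq
  have hc : Continuous fun s : ℝ => quadObjective A f w u + 1 / 2 * (1 - s) * q := by fun_prop
  have h1 := (hc.tendsto 0).mono_left (nhdsWithin_le_nhds (s := Set.Ioi 0))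
  rw [sub_zero, mul_one] at h1
  refine le_of_tendsto h1 ?_
  filter_upwards [self_mem_nhdsWithin,
    nhdsWithin_le_nhds (eventually_le_nhds (zero_lt_one' ℝ))] with s hs hs1
  have hs0 : (0 : ℝ) < s := hs
  have h2 := (isMinOn_univ_iff.mp hu (u + s • (v - u))).trans
    (quadObjective_add_smul_le A hf w u v hs0.le hs1)
  rw [← hq] at h2
  refine le_of_mul_le_mul_left ?_ hs0
  linarith

theorem continuous_of_convexOn_univ (hf : ConvexOn ℝ Set.univ f) : Continuous f :=
  continuousOn_univ.mp (hf.continuousOn isOpen_univ)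

/-- The quadratic term dominates the linear bounds on the rest, so the function is coercive;
quadratic growth around a minimizer excludes a second one. -/
theorem existsUnique_isMinOn_quadObjective (hf : ConvexOn ℝ Set.univ f) (hm : 0 < m)
    (hC : ∀ u : EuclideanSpace ℝ (Fin p), m * ‖u‖ ^ 2 ≤ ⇑u ⬝ᵥ C *ᵥ ⇑u) {B : ℝ}
    (hB : ∀ u, |f u| ≤ B * ‖u‖) (w : EuclideanSpace ℝ (Fin p)) :
    ∃! u, IsMinOn (quadObjective C f w) Set.univ u := by
  have hcont : Continuous (quadObjective C f w) := by
    have := continuous_of_convexOn_univ hf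
    unfold quadObjective
    simp only [dotProduct, Matrix.mulVec]
    fun_prop
  have htend : Tendsto (quadObjective C f w) (cocompact _) atTop := by
    have h1 : Tendsto (fun x : ℝ => x * (m / 2 * x - (‖w‖ + B))) atTop atTop :=
      tendsto_id.atTop_mul_atTop₀ (tendsto_atTop_add_const_right _ _
        (tendsto_id.const_mul_atTop (by positivity)))
    refine tendsto_atTop_mono (fun u => ?_)
      (h1.comp (tendsto_norm_cocompact_atTop (E := EuclideanSpace ℝ (Fin p))))
    have h2 := dotProduct_le_norm_mul_norm u w
    have h3 := (abs_le.mp (hB u)).1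
    have h4 := hC u
    simp only [Function.comp_apply, quadObjective]
    nlinarith
  obtain ⟨u, hu⟩ := hcont.exists_forall_le htend
  have hu' : IsMinOn (quadObjective C f w) Set.univ u := isMinOn_univ_iff.mpr hu
  refine ⟨u, hu', fun v hv => ?_⟩
  have h1 := quadObjective_add_le_of_isMinOn hf hu' v
  have h2 := isMinOn_univ_iff.mp hv u
  have h3 := hC (v - u)
  have h4 : ‖v - u‖ ^ 2 ≤ 0 := by
    by_contra h
    have := mul_pos hm (not_le.mp h)
    linarith
  rw [← sub_eq_zero, ← norm_eq_zero]
  exact pow_eq_zero_iff two_ne_zero |>.mp (le_antisymm h4 (sq_nonneg _))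

/-- Adding the growth inequalities at the two minimizers cancels `f` and leaves `m ‖v - u‖² ≤ ⟨v -
u, w' - w⟩`. -/
theorem norm_sub_le_of_isMinOn_quadObjective (hf : ConvexOn ℝ Set.univ f) (hm : 0 < m)
    (hC : ∀ u : EuclideanSpace ℝ (Fin p), m * ‖u‖ ^ 2 ≤ ⇑u ⬝ᵥ C *ᵥ ⇑u)
    {w' : EuclideanSpace ℝ (Fin p)}
    (hu : IsMinOn (quadObjective C f w) Set.univ u)
    (hv : IsMinOn (quadObjective C f w') Set.univ v) : ‖v - u‖ ≤ m⁻¹ * ‖w' - w‖ := by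
  have h1 := quadObjective_add_le_of_isMinOn hf hu v
  have h2 := quadObjective_add_le_of_isMinOn hf hv u
  have h3 := hC (v - u)
  have h4 := hC (u - v)
  have h5 := dotProduct_le_norm_mul_norm (v - u) (w' - w)
  rw [norm_sub_rev u v] at h4
  simp only [quadObjective, WithLp.ofLp_sub, dotProduct_sub, sub_dotProduct] at h1 h2 h3 h4 h5
  have h6 : m * ‖v - u‖ ^ 2 ≤ ‖v - u‖ * ‖w' - w‖ := by linarith
  rcases (norm_nonneg (v - u)).eq_or_lt with h | h
  · rw [← h]
    positivity
  · rw [← div_eq_inv_mul, le_div_iff₀ hm]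
    nlinarith

/-- A minimizer of a convex penalized quadratic function stays close to the minimizer of a
strongly convex one when the two functions are uniformly close on a ball around the latter. -/
theorem norm_sub_lt_of_isMinOn_quadObjective (hf : ConvexOn ℝ Set.univ f)
    (hC : ∀ u : EuclideanSpace ℝ (Fin p), m * ‖u‖ ^ 2 ≤ ⇑u ⬝ᵥ C *ᵥ ⇑u)
    (hg : ConvexOn ℝ Set.univ g) (hA : ∀ u : EuclideanSpace ℝ (Fin p), 0 ≤ ⇑u ⬝ᵥ A *ᵥ ⇑u)
    (hu : IsMinOn (quadObjective C f w) Set.univ u)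
    (hv : IsMinOn (quadObjective A g w) Set.univ v) {r η : ℝ} (hr : 0 < r)
    (hη : 2 * η < 1 / 2 * m * r ^ 2)
    (hclose : ∀ z, ‖z - u‖ ≤ r → |quadObjective A g w z - quadObjective C f w z| ≤ η) :
    ‖v - u‖ < r := by
  by_contra! h
  have hd : 0 < ‖v - u‖ := hr.trans_le h
  -- Since `v` may lie outside the ball where the functions are close, it is replaced by the point
  -- of the segment from `u` to `v` at distance `r`. By convexity this point does no worse than `u`
  -- for the perturbed function, whereas the limiting function has grown there by at least `½ m r²`.
  set s := r / ‖v - u‖ with hs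
  have hs0 : 0 < s := by positivity
  have hs1 : s ≤ 1 := (div_le_one hd).mpr h
  have hz : ‖(u + s • (v - u)) - u‖ = r := by
    rw [add_sub_cancel_left, norm_smul, Real.norm_of_nonneg hs0.le, hs, div_mul_cancel₀ _ hd.ne']
  have h1 := quadObjective_add_smul_le A hg w u v hs0.le hs1
  have h2 := isMinOn_univ_iff.mp hv u
  have h3 := abs_le.mp (hclose u (by simpa using hr.le))
  have h4 := abs_le.mp (hclose _ hz.le)
  have h5 := quadObjective_add_le_of_isMinOn hf hu (u + s • (v - u))
  have h6 := hC (u + s • (v - u) - u)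
  rw [hz] at h6
  have h7 : 0 ≤ 1 / 2 * s * (1 - s) * (⇑(v - u) ⬝ᵥ A *ᵥ ⇑(v - u)) :=
    mul_nonneg (mul_nonneg (by positivity) (sub_nonneg.mpr hs1)) (hA _)
  have h8 := mul_le_mul_of_nonneg_left h2 hs0.le
  linarith

theorem abs_quadObjective_sub_le (A C : Matrix (Fin p) (Fin p) ℝ)
    (f g : EuclideanSpace ℝ (Fin p) → ℝ) (w z : EuclideanSpace ℝ (Fin p)) :
    |quadObjective A g w z - quadObjective C f w z| ≤
      (∑ i, ∑ j, |A i j - C i j|) * ‖z‖ ^ 2 + |g z - f z| := by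
  have h1 := abs_quadForm_sub_le A C z
  have h2 : quadObjective A g w z - quadObjective C f w z =
      1 / 2 * (⇑z ⬝ᵥ A *ᵥ ⇑z - ⇑z ⬝ᵥ C *ᵥ ⇑z) + (g z - f z) := by
    unfold quadObjective
    ring
  rw [h2]
  refine (abs_add_le _ _).trans ?_
  rw [abs_mul, abs_of_pos (by norm_num : (0 : ℝ) < 1 / 2)]
  have := abs_nonneg (⇑z ⬝ᵥ A *ᵥ ⇑z - ⇑z ⬝ᵥ C *ᵥ ⇑z)
  linarith

/-- Stability of the minimizers, uniformly over bounded linear terms `w`. -/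
theorem exists_eventually_norm_sub_lt (hf : ConvexOn ℝ Set.univ f) (hm : 0 < m)
    (hC : ∀ u : EuclideanSpace ℝ (Fin p), m * ‖u‖ ^ 2 ≤ ⇑u ⬝ᵥ C *ᵥ ⇑u)
    {umin : EuclideanSpace ℝ (Fin p) → EuclideanSpace ℝ (Fin p)}
    (hmin : ∀ w, IsMinOn (quadObjective C f w) Set.univ (umin w))
    {g : ℕ → EuclideanSpace ℝ (Fin p) → ℝ} (hg : ∀ n, ConvexOn ℝ Set.univ (g n))
    (hgf : ∀ R η : ℝ, 0 < η → ∀ᶠ n in atTop, ∀ u, ‖u‖ ≤ R → |g n u - f u| ≤ η)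
    (K : ℝ) {r : ℝ} (hr : 0 < r) :
    ∃ δ > 0, ∀ᶠ n in atTop, ∀ (A : Matrix (Fin p) (Fin p) ℝ) (w v : EuclideanSpace ℝ (Fin p)),
      (∀ u : EuclideanSpace ℝ (Fin p), 0 ≤ ⇑u ⬝ᵥ A *ᵥ ⇑u) → ∑ i, ∑ j, |A i j - C i j| ≤ δ →
      ‖w‖ ≤ K → IsMinOn (quadObjective A (g n) w) Set.univ v → ‖v - umin w‖ < r := by
  -- By the Lipschitz bound, the ball of radius `R` about `0` contains every `r`-ball about `umin w`
  -- with `‖w‖ ≤ K`.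
  set R : ℝ := ‖umin 0‖ + m⁻¹ * K + r with hR
  set η : ℝ := m * r ^ 2 / 16 with hη
  have hη0 : 0 < η := by positivity
  -- This `δ` keeps the quadratic discrepancy below `η` on that ball; with another `η` for `g n - f`
  -- the total is `2η`, and `4η = m r² / 4 < m r² / 2`.
  refine ⟨η / (R ^ 2 + 1), by positivity, ?_⟩
  filter_upwards [hgf R η hη0] with n hn A w v hA hAC hw hv
  have h2η : 2 * (2 * η) < 1 / 2 * m * r ^ 2 := by
    have : 0 < m * r ^ 2 := by positivity
    rw [hη]
    linarith
  refine norm_sub_lt_of_isMinOn_quadObjective hf hC (hg n) hA (hmin w) hv hr h2η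
    fun z hz => ?_
  have h1 := norm_sub_le_of_isMinOn_quadObjective hf hm hC (hmin 0) (hmin w)
  have h2 : ‖z‖ ≤ R := by
    have h3 : z = (z - umin w) + (umin w - umin 0) + umin 0 := by abel
    have h4 := norm_add₃_le (a := z - umin w) (b := umin w - umin 0) (c := umin 0)
    rw [← h3] at h4
    have h5 : m⁻¹ * ‖w - 0‖ ≤ m⁻¹ * K := by
      rw [sub_zero]
      gcongr
    linarith
  refine (abs_quadObjective_sub_le A C f (g n) w z).trans ?_
  have h3 := hn z h2
  have h4 : (∑ i, ∑ j, |A i j - C i j|) * ‖z‖ ^ 2 ≤ η := by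
    calc (∑ i, ∑ j, |A i j - C i j|) * ‖z‖ ^ 2 ≤ η / (R ^ 2 + 1) * (R ^ 2 + 1) := by
          gcongr
          nlinarith [norm_nonneg z]
      _ = η := by field_simp
  linarith

end

end

/-! ### The SLOPE objective in local coordinates -/

section

variable {p : ℕ}

/-- The empirical second moment matrix `n⁻¹ ∑ xₖ xₖᵀ`. -/
noncomputable def empiricalGram (x : ℕ → EuclideanSpace ℝ (Fin p)) (n : ℕ) :
    Matrix (Fin p) (Fin p) ℝ :=
  Matrix.of fun i j => (n : ℝ)⁻¹ * ∑ k ∈ Finset.range n, x k i * x k j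

/-- The normalized score `n^{-1/2} ∑ eₖ xₖ`. -/
noncomputable def score (x : ℕ → EuclideanSpace ℝ (Fin p)) (e : ℕ → ℝ) (n : ℕ) :
    EuclideanSpace ℝ (Fin p) :=
  (√(n : ℝ))⁻¹ • ∑ k ∈ Finset.range n, e k • x k

/-- The local increment `J_l(b + c u) - J_l(b)` of the SLOPE norm. -/
noncomputable def slopeIncrement (l : Fin p → ℝ) (b : EuclideanSpace ℝ (Fin p)) (c : ℝ)
    (u : EuclideanSpace ℝ (Fin p)) : ℝ :=
  slopeNorm l (b + c • u) - slopeNorm l b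

theorem convexOn_slopeIncrement {l : Fin p → ℝ} (hl : IsPenalty l)
    (b : EuclideanSpace ℝ (Fin p)) (c : ℝ) : ConvexOn ℝ Set.univ (slopeIncrement l b c) := by
  refine ⟨convex_univ, fun x _ y _ s t hs ht hst => ?_⟩
  have h := (convexOn_slopeNorm hl).2 (Set.mem_univ (b + c • x)) (Set.mem_univ (b + c • y))
    hs ht hst
  have h1 : s • (b + c • x) + t • (b + c • y) = b + c • (s • x + t • y) := by
    have : b = (s + t) • b := by rw [hst, one_smul]
    conv_rhs => rw [this]
    module
  rw [h1] at h
  have h2 : slopeNorm l b = s * slopeNorm l b + t * slopeNorm l b := by rw [← add_mul, hst, one_mul]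
  simp only [slopeIncrement, smul_eq_mul] at h ⊢
  linarith

/-- Once `R/√n` is within the radius of affinity, the increment is exactly linear in `lamSeq n /
√n`. The permutation `s` does not depend on the penalty, so the error is at most `R` times the `ℓ¹`
distance between the penalties. -/
theorem eventually_abs_slopeIncrement_sub_le {lamSeq : ℕ → Fin p → ℝ} {lam : Fin p → ℝ}
    (hlam : Tendsto (fun n : ℕ => (√(n : ℝ))⁻¹ • lamSeq n) atTop (𝓝 lam))
    (b : EuclideanSpace ℝ (Fin p)) (R : ℝ) {η : ℝ} (hη : 0 < η) :
    ∀ᶠ n : ℕ in atTop, ∀ u, ‖u‖ ≤ R →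
      |slopeIncrement (lamSeq n) b (√(n : ℝ))⁻¹ u - dirDeriv (slopeNorm lam) b u| ≤ η := by
  obtain ⟨r, hr, h⟩ := exists_radius_slopeNorm b
  have h1 : Tendsto (fun n : ℕ => (∑ j, |((√(n : ℝ))⁻¹ • lamSeq n) j - lam j|) * R) atTop
      (𝓝 ((∑ j, |lam j - lam j|) * R)) :=
    (tendsto_finsetSum _ fun j _ => (((tendsto_pi_nhds.mp hlam) j).sub_const _).abs).mul_const R
  simp only [sub_self, abs_zero, Finset.sum_const_zero, zero_mul] at h1
  filter_upwards [eventually_inv_sqrt_mul_le R hr, h1.eventually_le_const hη] with n hn hn' u hu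
  obtain ⟨s, hs⟩ := h u
  have hc : 0 ≤ (√(n : ℝ))⁻¹ := by positivity
  have h2 := (hs (lamSeq n)).2.2 _ hc ((mul_le_mul_of_nonneg_left hu hc).trans hn)
  rw [slopeIncrement, h2, add_sub_cancel_left, (hs lam).2.1, (hs (lamSeq n)).2.1, Finset.mul_sum,
    ← Finset.sum_sub_distrib]
  refine le_trans ((Finset.abs_sum_le_sum_abs _ _).trans ?_) hn'
  rw [Finset.sum_mul]
  refine Finset.sum_le_sum fun j _ => ?_
  rw [← mul_assoc, ← sub_mul, abs_mul]
  exact mul_le_mul_of_nonneg_left ((abs_absDirDeriv_le b u _).trans hu) (abs_nonneg _)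

theorem quadForm_empiricalGram (x : ℕ → EuclideanSpace ℝ (Fin p)) (n : ℕ)
    (u : EuclideanSpace ℝ (Fin p)) :
    ⇑u ⬝ᵥ empiricalGram x n *ᵥ ⇑u = (n : ℝ)⁻¹ * ∑ k ∈ Finset.range n, (⇑(x k) ⬝ᵥ ⇑u) ^ 2 := by
  simp only [dotProduct, Matrix.mulVec, empiricalGram, Matrix.of_apply, sq,
    Finset.mul_sum, Finset.sum_mul]
  rw [Finset.sum_comm (s := Finset.range n)]
  refine Finset.sum_congr rfl fun i _ => ?_
  rw [Finset.sum_comm (s := Finset.range n)]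
  refine Finset.sum_congr rfl fun j _ => Finset.sum_congr rfl fun k _ => ?_
  ring

theorem quadForm_empiricalGram_nonneg (x : ℕ → EuclideanSpace ℝ (Fin p)) (n : ℕ)
    (u : EuclideanSpace ℝ (Fin p)) : 0 ≤ ⇑u ⬝ᵥ empiricalGram x n *ᵥ ⇑u := by
  rw [quadForm_empiricalGram]
  positivity

theorem dotProduct_score (x : ℕ → EuclideanSpace ℝ (Fin p)) (e : ℕ → ℝ) (n : ℕ)
    (u : EuclideanSpace ℝ (Fin p)) :
    ⇑u ⬝ᵥ ⇑(score x e n) = (√(n : ℝ))⁻¹ * ∑ k ∈ Finset.range n, e k * (⇑(x k) ⬝ᵥ ⇑u) := by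
  simp only [dotProduct_eq_inner, score, inner_smul_right, inner_sum, real_inner_comm u]

theorem slopeObjective_add_smul (x : ℕ → EuclideanSpace ℝ (Fin p)) (e : ℕ → ℝ)
    (b u : EuclideanSpace ℝ (Fin p)) (l : Fin p → ℝ) (n : ℕ) :
    slopeObjective (designMatrix x n) (response x e b n) l (b + (√(n : ℝ))⁻¹ • u) =
      quadObjective (empiricalGram x n) (slopeIncrement l b (√(n : ℝ))⁻¹) (score x e n) u +
        (1 / 2 * ∑ k ∈ Finset.range n, e k ^ 2 + slopeNorm l b) := by
  have h1 : ∀ k : Fin n, (response x e b n - designMatrix x n *ᵥ ⇑(b + (√(n : ℝ))⁻¹ • u)) k =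
      e k - (√(n : ℝ))⁻¹ * (⇑(x k) ⬝ᵥ ⇑u) := by
    intro k
    simp only [response, Pi.sub_apply, WithLp.ofLp_add, WithLp.ofLp_smul, Matrix.mulVec_add,
      Matrix.mulVec_smul, Pi.add_apply, Pi.smul_apply, smul_eq_mul]
    have : (designMatrix x n *ᵥ ⇑u) k = ⇑(x k) ⬝ᵥ ⇑u := rfl
    rw [this]
    ring
  have h2 : ((√(n : ℝ))⁻¹) ^ 2 = (n : ℝ)⁻¹ := by rw [inv_pow, Real.sq_sqrt n.cast_nonneg]
  have h3 : ‖WithLp.toLp 2 (response x e b n - designMatrix x n *ᵥ ⇑(b + (√(n : ℝ))⁻¹ • u))‖ ^ 2 =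
      ∑ k ∈ Finset.range n, (e k - (√(n : ℝ))⁻¹ * (⇑(x k) ⬝ᵥ ⇑u)) ^ 2 := by
    rw [EuclideanSpace.norm_sq_eq, Finset.sum_range]
    refine Finset.sum_congr rfl fun k _ => ?_
    rw [Real.norm_eq_abs, sq_abs]
    exact congrArg (· ^ 2) (h1 k)
  have h4 : ∑ k ∈ Finset.range n, (e k - (√(n : ℝ))⁻¹ * (⇑(x k) ⬝ᵥ ⇑u)) ^ 2 =
      ∑ k ∈ Finset.range n, e k ^ 2 - 2 * (⇑u ⬝ᵥ ⇑(score x e n)) +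
        ⇑u ⬝ᵥ empiricalGram x n *ᵥ ⇑u := by
    rw [dotProduct_score, quadForm_empiricalGram, ← h2, Finset.mul_sum, Finset.mul_sum,
      Finset.mul_sum, ← Finset.sum_sub_distrib, ← Finset.sum_add_distrib]
    refine Finset.sum_congr rfl fun k _ => ?_
    ring
  rw [slopeObjective, h3, h4, quadObjective, slopeIncrement]
  ring

theorem isMinOn_quadObjective_of_isMinOn_slopeObjective {x : ℕ → EuclideanSpace ℝ (Fin p)}
    {e : ℕ → ℝ} {b bhat : EuclideanSpace ℝ (Fin p)} {l : Fin p → ℝ} {n : ℕ} (hn : 0 < n)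
    (h : IsMinOn (slopeObjective (designMatrix x n) (response x e b n) l) Set.univ bhat) :
    IsMinOn (quadObjective (empiricalGram x n) (slopeIncrement l b (√(n : ℝ))⁻¹) (score x e n))
      Set.univ (√(n : ℝ) • (bhat - b)) := by
  refine isMinOn_univ_iff.mpr fun u => ?_
  have h1 := isMinOn_univ_iff.mp h (b + (√(n : ℝ))⁻¹ • u)
  have h2 : bhat = b + (√(n : ℝ))⁻¹ • (√(n : ℝ) • (bhat - b)) := by
    rw [smul_smul, inv_mul_cancel₀ (by positivity), one_smul, add_sub_cancel]
  rw [h2, slopeObjective_add_smul, slopeObjective_add_smul] at h1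
  simpa using h1

end

/-! ### Laws of large numbers, central limit theorem and tightness -/

section

section

variable {ι Ω α β : Type*} [MeasurableSpace Ω] [MeasurableSpace α] [MeasurableSpace β]
  {P : Measure Ω} [IsProbabilityMeasure P]

/-- Two independent families of independent random variables give an independent family of pairs. -/
theorem iIndepFun_prodMk {X : ι → Ω → α} {Y : ι → Ω → β}
    (hX : ∀ i, AEMeasurable (X i) P) (hY : ∀ i, AEMeasurable (Y i) P)
    (hX_indep : iIndepFun X P) (hY_indep : iIndepFun Y P)
    (hXY : IndepFun (fun ω i => X i ω) (fun ω i => Y i ω) P) :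
    iIndepFun (fun i ω => (X i ω, Y i ω)) P := by
  rw [iIndepFun_iff_finset]
  intro s
  have hXs : ∀ i : s, AEMeasurable (X i) P := fun i => hX i
  have hYs : ∀ i : s, AEMeasurable (Y i) P := fun i => hY i
  have hXYs : ∀ i : s, AEMeasurable (s.restrict (fun i ω => (X i ω, Y i ω)) i) P :=
    fun i => (hX i).prodMk (hY i)
  rw [iIndepFun_iff_map_fun_eq_pi_map hXYs]
  have hpair : ∀ i, P.map (fun ω => (X i ω, Y i ω)) = (P.map (X i)).prod (P.map (Y i)) := by
    intro i
    refine (indepFun_iff_map_prod_eq_prod_map_map (hX i) (hY i)).mp ?_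
    exact hXY.comp (measurable_pi_apply i) (measurable_pi_apply i)
  have hs : IndepFun (fun ω (i : s) => X i ω) (fun ω (i : s) => Y i ω) P :=
    hXY.comp (φ := fun (x : ι → α) (i : s) => x i) (ψ := fun (y : ι → β) (i : s) => y i)
      (by fun_prop) (by fun_prop)
  have h1 := (indepFun_iff_map_prod_eq_prod_map_map (aemeasurable_pi_lambda _ hXs)
    (aemeasurable_pi_lambda _ hYs)).mp hs
  have h2 := (iIndepFun_iff_map_fun_eq_pi_map hXs).mp (iIndepFun_iff_finset.mp hX_indep s)
  have h3 := (iIndepFun_iff_map_fun_eq_pi_map hYs).mp (iIndepFun_iff_finset.mp hY_indep s)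
  rw [h2, h3] at h1
  have _ (i : s) : IsProbabilityMeasure (P.map (X i)) := Measure.isProbabilityMeasure_map (hX i)
  have _ (i : s) : IsProbabilityMeasure (P.map (Y i)) := Measure.isProbabilityMeasure_map (hY i)
  -- Regrouping a pair of families into a family of pairs turns the product of the two product laws
  -- into the product of the pair laws.
  have h4 := (measurePreserving_arrowProdEquivProdArrow α β s (fun i => P.map (X i))
    (fun i => P.map (Y i))).symm.map_eq
  rw [← h1, AEMeasurable.map_map_of_aemeasurable (by fun_prop)
    ((aemeasurable_pi_lambda _ hXs).prodMk (aemeasurable_pi_lambda _ hYs))] at h4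
  simp only [Finset.restrict, hpair]
  exact h4

end

variable {p : ℕ} {Ω Ω' : Type*} [MeasurableSpace Ω] [MeasurableSpace Ω']
  {P : Measure Ω} {P' : Measure Ω'}

theorem memLp_apply {Z : Ω → EuclideanSpace ℝ (Fin p)} (hZ : MemLp Z 2 P) (i : Fin p) :
    MemLp (fun ω => Z ω i) 2 P :=
  (EuclideanSpace.proj (𝕜 := ℝ) i).comp_memLp' hZ

theorem integral_apply {Z : Ω → EuclideanSpace ℝ (Fin p)} (hZ : Integrable Z P) (i : Fin p) :
    ∫ ω, Z ω i ∂P = (∫ ω, Z ω ∂P) i :=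
  (EuclideanSpace.proj (𝕜 := ℝ) i).integral_comp_comm hZ

theorem memLp_two_smul_of_indepFun {Z : Ω → EuclideanSpace ℝ (Fin p)} {e : Ω → ℝ}
    (hZ : MemLp Z 2 P) (he : MemLp e 2 P) (hindep : IndepFun e Z P) :
    MemLp (fun ω => e ω • Z ω) 2 P := by
  refine (memLp_two_iff_integrable_sq_norm (he.1.smul hZ.1)).mpr ?_
  have h1 : IndepFun (fun ω => e ω ^ 2) (fun ω => ‖Z ω‖ ^ 2) P :=
    hindep.comp (φ := fun x : ℝ => x ^ 2) (ψ := fun z : EuclideanSpace ℝ (Fin p) => ‖z‖ ^ 2)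
      (by fun_prop) (by fun_prop)
  have h2 := h1.integrable_mul he.integrable_sq ((memLp_two_iff_integrable_sq_norm hZ.1).mp hZ)
  refine h2.congr (ae_of_all _ fun ω => ?_)
  simp [norm_smul, mul_pow]

theorem integral_inner_sq {Z : Ω → EuclideanSpace ℝ (Fin p)} (hZ : MemLp Z 2 P)
    {S : Matrix (Fin p) (Fin p) ℝ} (hS : ∀ i j, ∫ ω, Z ω i * Z ω j ∂P = S i j)
    (t : EuclideanSpace ℝ (Fin p)) :
    ∫ ω, (inner ℝ (Z ω) t) ^ 2 ∂P = ⇑t ⬝ᵥ S *ᵥ ⇑t := by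
  have h1 : ∀ ω, (inner ℝ (Z ω) t) ^ 2 = ∑ i, ∑ j, t i * t j * (Z ω i * Z ω j) := by
    intro ω
    rw [← dotProduct_eq_inner, sq, dotProduct, Finset.sum_mul_sum]
    refine Finset.sum_congr rfl fun i _ => Finset.sum_congr rfl fun j _ => ?_
    ring
  have h2 : ∀ i j, Integrable (fun ω => t i * t j * (Z ω i * Z ω j)) P := fun i j =>
    ((memLp_apply hZ i).integrable_mul (memLp_apply hZ j)).const_mul _
  simp_rw [h1]
  rw [integral_finsetSum _ fun i _ => integrable_finsetSum _ fun j _ => h2 i j]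
  simp only [dotProduct, Matrix.mulVec, Finset.mul_sum]
  refine Finset.sum_congr rfl fun i _ => ?_
  rw [integral_finsetSum _ fun j _ => h2 i j]
  refine Finset.sum_congr rfl fun j _ => ?_
  rw [integral_const_mul, hS]
  ring

/-- The Cramér–Wold reduction to one-dimensional projections. -/
theorem charFun_map_eq_charFun_map_inner {Z : Ω → EuclideanSpace ℝ (Fin p)}
    (hZ : AEMeasurable Z P) (t : EuclideanSpace ℝ (Fin p)) :
    charFun (P.map Z) t = charFun (P.map fun ω => inner ℝ (Z ω) t) 1 := by
  rw [charFun_apply, charFun_apply, integral_map hZ (by fun_prop),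
    integral_map (by fun_prop) (by fun_prop)]
  simp

theorem ae_tendsto_empiricalGram {X : ℕ → Ω → EuclideanSpace ℝ (Fin p)}
    (hindep : iIndepFun X P) (hident : ∀ i, IdentDistrib (X i) (X 0) P P)
    (hL2 : MemLp (X 0) 2 P) {C : Matrix (Fin p) (Fin p) ℝ}
    (hcov : ∀ i j, ∫ ω, X 0 ω i * X 0 ω j ∂P = C i j) :
    ∀ᵐ ω ∂P, Tendsto (fun n => ∑ i, ∑ j, |empiricalGram (fun k => X k ω) n i j - C i j|) atTop
      (𝓝 0) := by
  have h : ∀ i j, ∀ᵐ ω ∂P,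
      Tendsto (fun n => empiricalGram (fun k => X k ω) n i j) atTop (𝓝 (C i j)) := by
    intro i j
    have hm : Measurable fun z : EuclideanSpace ℝ (Fin p) => z i * z j := by fun_prop
    have h1 := strong_law_ae (μ := P) (fun k ω => X k ω i * X k ω j)
      ((memLp_apply hL2 i).integrable_mul (memLp_apply hL2 j))
      (fun k l hkl => (hindep.indepFun hkl).comp hm hm) (fun k => (hident k).comp hm)
    rw [hcov] at h1
    simpa [empiricalGram] using h1
  filter_upwards [ae_all_iff.mpr fun i => ae_all_iff.mpr (h i)] with ω hω
  have h2 := tendsto_finsetSum (Finset.univ : Finset (Fin p)) fun i _ =>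
    tendsto_finsetSum (Finset.univ : Finset (Fin p)) fun j _ => ((hω i j).sub_const (C i j)).abs
  simpa using h2

variable [IsProbabilityMeasure P] [IsProbabilityMeasure P']

/-- The central limit theorem for i.i.d. centered square-integrable random vectors. -/
theorem tendstoInDistribution_inv_sqrt_smul_sum {Z : ℕ → Ω → EuclideanSpace ℝ (Fin p)}
    (hindep : iIndepFun Z P) (hident : ∀ i, IdentDistrib (Z i) (Z 0) P P)
    (hL2 : MemLp (Z 0) 2 P) (hmean : ∫ ω, Z 0 ω ∂P = 0) {S : Matrix (Fin p) (Fin p) ℝ}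
    (hS : S.PosSemidef) (hcov : ∀ i j, ∫ ω, Z 0 ω i * Z 0 ω j ∂P = S i j)
    {W : Ω' → EuclideanSpace ℝ (Fin p)} (hW : HasLaw W (multivariateGaussian 0 S) P') :
    TendstoInDistribution (fun (n : ℕ) ω => (√(n : ℝ))⁻¹ • ∑ k ∈ Finset.range n, Z k ω) atTop W
      (fun _ => P) P' := by
  have hmeas : ∀ n : ℕ,
      AEMeasurable (fun ω => (√(n : ℝ))⁻¹ • ∑ k ∈ Finset.range n, Z k ω) P := fun n =>
    (Finset.aemeasurable_fun_sum _ fun k _ => (hident k).aemeasurable_fst).const_smul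
      (√(n : ℝ))⁻¹
  refine ⟨hmeas, hW.aemeasurable, ProbabilityMeasure.tendsto_iff_tendsto_charFun.2 fun t => ?_⟩
  have hint : ∫ ω, inner ℝ (Z 0 ω) t ∂P = 0 := by
    have h := integral_inner (hL2.integrable (by norm_num)) (𝕜 := ℝ) t
    simp_rw [real_inner_comm t, h, hmean, inner_zero_right]
  have hL2t : MemLp (fun ω => inner ℝ (Z 0 ω) t) 2 P := hL2.inner_const t
  have hvar : Var[fun ω => inner ℝ (Z 0 ω) t; P] = ⇑t ⬝ᵥ S *ᵥ ⇑t := by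
    rw [variance_of_integral_eq_zero hL2t.aemeasurable hint, integral_inner_sq hL2 hcov]
  have hnn : 0 ≤ ⇑t ⬝ᵥ S *ᵥ ⇑t := by
    rw [← hvar]
    exact variance_nonneg _ _
  -- The scalar central limit theorem for the projections on `t`; evaluating its characteristic
  -- functions at `1` gives those of the vectors at `t`.
  have hclt := tendstoInDistribution_inv_sqrt_mul_sum_sub (P := P)
    (X := fun k ω => inner ℝ (Z k ω) t)
    (HasLaw.id (μ := gaussianReal 0 Var[fun ω => inner ℝ (Z 0 ω) t; P].toNNReal)) hL2t
    (hindep.comp (fun _ z => inner ℝ z t) (by fun_prop))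
    (fun k => (hident k).comp (u := fun z => inner ℝ z t) (by fun_prop))
  have h1 := ProbabilityMeasure.tendsto_iff_tendsto_charFun.1 hclt.tendsto 1
  simp only [ProbabilityMeasure.coe_mk, Measure.map_id, hvar, hint, mul_zero, sub_zero] at h1 ⊢
  rw [hW.map_eq, charFun_multivariateGaussian hS]
  rw [charFun_gaussianReal] at h1
  convert h1 using 2 with n
  · rw [charFun_map_eq_charFun_map_inner (hmeas n)]
    simp_rw [real_inner_smul_left, sum_inner]
  · simp [hnn]

/-- Convergence of characteristic functions to one that is continuous at `0` implies tightness. -/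
theorem exists_measure_norm_gt_le {Y : ℕ → Ω → EuclideanSpace ℝ (Fin p)}
    {W : Ω' → EuclideanSpace ℝ (Fin p)}
    (h : TendstoInDistribution Y atTop W (fun _ => P) P') {η : ENNReal} (hη : 0 < η) :
    ∃ K : ℝ, ∀ n, P {ω | K < ‖Y n ω‖} ≤ η := by
  have h1 := ProbabilityMeasure.tendsto_iff_tendsto_charFun.1 h.tendsto
  have _ (n : ℕ) : IsProbabilityMeasure (P.map (Y n)) :=
    Measure.isProbabilityMeasure_map (h.forall_aemeasurable n)
  have _ : IsProbabilityMeasure (P'.map W) :=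
    Measure.isProbabilityMeasure_map h.aemeasurable_limit
  have h2 := isTightMeasureSet_of_tendsto_charFun (μ := fun n => P.map (Y n))
    (f := charFun (P'.map W)) (by fun_prop) h1
  obtain ⟨T, hT, hle⟩ := isTightMeasureSet_iff_exists_isCompact_measure_compl_le.mp h2 η hη
  obtain ⟨K, hK⟩ := hT.isBounded.exists_norm_le
  refine ⟨K, fun n => ?_⟩
  have h3 := hle _ ⟨n, rfl⟩
  rw [Measure.map_apply_of_aemeasurable (h.forall_aemeasurable n) hT.measurableSet.compl] at h3
  refine (measure_mono fun ω hω hmem => ?_).trans h3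
  exact absurd (hK _ hmem) (not_le.mpr hω)

end

/-! ### Asymptotic normality of the score and convergence of minimizers -/

section

variable {p : ℕ} {Ω Ω' : Type*} [MeasurableSpace Ω] [MeasurableSpace Ω']
  {P : Measure Ω} [IsProbabilityMeasure P] {P' : Measure Ω'} [IsProbabilityMeasure P']

theorem integral_mul_of_covariance_eq {Z : Ω → EuclideanSpace ℝ (Fin p)} (hZ : MemLp Z 2 P)
    (hmean : ∫ ω, Z ω ∂P = 0) {C : Matrix (Fin p) (Fin p) ℝ}
    (hcov : ∀ i j, cov[fun ω => Z ω i, fun ω => Z ω j; P] = C i j) (i j : Fin p) :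
    ∫ ω, Z ω i * Z ω j ∂P = C i j := by
  have h0 : ∀ i, ∫ ω, Z ω i ∂P = 0 := fun i => by
    rw [integral_apply (hZ.integrable (by norm_num)), hmean]
    rfl
  have h := covariance_eq_sub (memLp_apply hZ i) (memLp_apply hZ j)
  rw [hcov, h0, h0, mul_zero, sub_zero] at h
  exact h.symm

/-- Asymptotic normality of the normalized score of the linear model. -/
theorem tendstoInDistribution_score {X : ℕ → Ω → EuclideanSpace ℝ (Fin p)} {ε : ℕ → Ω → ℝ}
    {C : Matrix (Fin p) (Fin p) ℝ} {σ : ℝ}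
    (hX_indep : iIndepFun X P) (hX_ident : ∀ i, IdentDistrib (X i) (X 0) P P)
    (hX_L2 : MemLp (X 0) 2 P) (hX_cov : ∀ i j, ∫ ω, X 0 ω i * X 0 ω j ∂P = C i j)
    (hε_indep : iIndepFun ε P) (hε_ident : ∀ i, IdentDistrib (ε i) (ε 0) P P)
    (hε_L2 : MemLp (ε 0) 2 P) (hε_mean : ∫ ω, ε 0 ω ∂P = 0) (hε_var : Var[ε 0; P] = σ ^ 2)
    (hXε : IndepFun (fun ω i => X i ω) (fun ω i => ε i ω) P) (hC : C.PosSemidef)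
    {W : Ω' → EuclideanSpace ℝ (Fin p)}
    (hW : HasLaw W (multivariateGaussian 0 (σ ^ 2 • C)) P') :
    TendstoInDistribution (fun (n : ℕ) ω => score (fun k => X k ω) (fun k => ε k ω) n) atTop W
      (fun _ => P) P' := by
  have hX_meas := fun k => (hX_ident k).aemeasurable_fst
  have hε_meas := fun k => (hε_ident k).aemeasurable_fst
  have hind : ∀ k, IndepFun (X k) (ε k) P := fun k =>
    hXε.comp (measurable_pi_apply k) (measurable_pi_apply k)
  have hm : Measurable fun z : EuclideanSpace ℝ (Fin p) × ℝ => z.2 • z.1 := by fun_prop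
  refine tendstoInDistribution_inv_sqrt_smul_sum (Z := fun k ω => ε k ω • X k ω)
    ((iIndepFun_prodMk hX_meas hε_meas hX_indep hε_indep hXε).comp (fun _ z => z.2 • z.1)
      fun _ => hm)
    (fun k => ((hX_ident k).prodMk (hε_ident k) (hind k) (hind 0)).comp hm)
    (memLp_two_smul_of_indepFun hX_L2 hε_L2 (hind 0).symm) ?_
    (hC.smul (sq_nonneg σ)) (fun i j => ?_) hW
  · rw [(hind 0).symm.integral_fun_smul_eq_smul_integral hε_L2.1 hX_L2.1, hε_mean, zero_smul]
  -- By independence the second moments of `ε 0 • X 0` factor as `E ε² · E Xᵢ Xⱼ = σ² C i j`.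
  · have h1 : IndepFun (fun ω => ε 0 ω ^ 2) (fun ω => X 0 ω i * X 0 ω j) P :=
      (hind 0).symm.comp (φ := fun x : ℝ => x ^ 2)
        (ψ := fun z : EuclideanSpace ℝ (Fin p) => z i * z j) (by fun_prop) (by fun_prop)
    have h2 := h1.integral_fun_mul_eq_mul_integral (hε_L2.1.pow 2)
      ((memLp_apply hX_L2 i).1.mul (memLp_apply hX_L2 j).1)
    rw [hX_cov, ← variance_of_integral_eq_zero hε_L2.aemeasurable hε_mean, hε_var] at h2
    rw [Matrix.smul_apply, smul_eq_mul, ← h2]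
    refine integral_congr_ae (ae_of_all _ fun ω => ?_)
    simp only [PiLp.smul_apply, smul_eq_mul]
    ring

/-- If the minimizers `v n` of random penalized quadratic functions have linear terms `Y n` that
converge in distribution and quadratic terms that converge in probability, then they converge in
distribution to the minimizer of the limiting function. -/
theorem tendstoInDistribution_of_isMinOn_quadObjective {C : Matrix (Fin p) (Fin p) ℝ}
    {f : EuclideanSpace ℝ (Fin p) → ℝ} (hf : ConvexOn ℝ Set.univ f) {m : ℝ} (hm : 0 < m)
    (hC : ∀ u : EuclideanSpace ℝ (Fin p), m * ‖u‖ ^ 2 ≤ ⇑u ⬝ᵥ C *ᵥ ⇑u)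
    {umin : EuclideanSpace ℝ (Fin p) → EuclideanSpace ℝ (Fin p)}
    (hmin : ∀ w, IsMinOn (quadObjective C f w) Set.univ (umin w))
    {g : ℕ → EuclideanSpace ℝ (Fin p) → ℝ} (hg : ∀ n, ConvexOn ℝ Set.univ (g n))
    (hgf : ∀ R η : ℝ, 0 < η → ∀ᶠ n in atTop, ∀ u, ‖u‖ ≤ R → |g n u - f u| ≤ η)
    {A : ℕ → Ω → Matrix (Fin p) (Fin p) ℝ}
    (hA : ∀ n ω, ∀ u : EuclideanSpace ℝ (Fin p), 0 ≤ ⇑u ⬝ᵥ A n ω *ᵥ ⇑u)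
    (hAC : TendstoInMeasure P (fun n ω => ∑ i, ∑ j, |A n ω i j - C i j|) atTop fun _ => 0)
    {Y : ℕ → Ω → EuclideanSpace ℝ (Fin p)} {W : Ω' → EuclideanSpace ℝ (Fin p)}
    (hY : TendstoInDistribution Y atTop W (fun _ => P) P')
    {v : ℕ → Ω → EuclideanSpace ℝ (Fin p)} (hv_meas : ∀ n, AEMeasurable (v n) P)
    (hv : ∀ᶠ n in atTop, ∀ᵐ ω ∂P, IsMinOn (quadObjective (A n ω) (g n) (Y n ω)) Set.univ (v n ω)) :
    TendstoInDistribution v atTop (umin ∘ W) (fun _ => P) P' := by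
  have hcont : Continuous umin := by
    refine (LipschitzWith.of_dist_le_mul (K := (m⁻¹).toNNReal) fun x y => ?_).continuous
    rw [Real.coe_toNNReal _ (by positivity), dist_eq_norm, dist_eq_norm]
    exact norm_sub_le_of_isMinOn_quadObjective hf hm hC (hmin y) (hmin x)
  -- Slutsky: `umin (Y n)` converges in law by continuity of `umin`, so it remains to show that `v n
  -- - umin (Y n)` tends to `0` in probability.
  refine tendstoInDistribution_of_tendstoInMeasure_sub v (umin ∘ W) (hY.continuous_comp hcont) ?_
    hv_meas
  rw [tendstoInMeasure_iff_norm] at hAC ⊢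
  intro r hr
  rw [ENNReal.tendsto_nhds_zero]
  intro η hη
  have hη2 : 0 < η / 2 := ENNReal.half_pos hη.ne'
  obtain ⟨K, hK⟩ := exists_measure_norm_gt_le hY hη2
  obtain ⟨δ, hδ, hstab⟩ := exists_eventually_norm_sub_lt hf hm hC hmin hg hgf K hr
  filter_upwards [hstab, hv, ENNReal.tendsto_nhds_zero.mp (hAC δ hδ) _ hη2] with n hn hvn hAn
  rw [← ENNReal.add_halves η]
  -- Up to a null set, a deviation of at least `r` forces either `‖Y n‖ > K` or a Gram error of at
  -- least `δ`; each has probability at most `η / 2`.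
  refine le_trans ?_ ((measure_union_le _ _).trans (add_le_add (hK n) hAn))
  refine measure_mono_ae ?_
  filter_upwards [hvn] with ω hω hmem
  by_contra hnot
  obtain ⟨h1', h2'⟩ := not_or.mp (show ¬(K < ‖Y n ω‖ ∨
    δ ≤ ‖∑ i, ∑ j, |A n ω i j - C i j| - 0‖) from hnot)
  have h1 : ‖Y n ω‖ ≤ K := not_lt.mp h1'
  have h2 : ∑ i, ∑ j, |A n ω i j - C i j| ≤ δ := by
    rw [sub_zero] at h2'
    exact (le_abs_self _).trans (not_le.mp h2').le
  have h4 := hn (A n ω) (Y n ω) (v n ω) (hA n ω) h2 h1 hω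
  have h5 : r ≤ ‖v n ω - umin (Y n ω)‖ := by simpa using! hmem
  exact absurd h5 (not_le.mpr h4)

end

end Slope

/-! ### Asymptotic distribution of the SLOPE estimator -/

theorem mainTheorem3 {p : ℕ} {Ω Ω' : Type*} [MeasurableSpace Ω] [MeasurableSpace Ω']
    (P : Measure Ω) [IsProbabilityMeasure P] (P' : Measure Ω') [IsProbabilityMeasure P']
    (β₀ : EuclideanSpace ℝ (Fin p)) (C : Matrix (Fin p) (Fin p) ℝ) (σ : ℝ)
    -- the regressors: i.i.d., centered, with covariance matrix `C`
    (X : ℕ → Ω → EuclideanSpace ℝ (Fin p))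
    (hX_indep : iIndepFun X P) (hX_ident : ∀ i, IdentDistrib (X i) (X 0) P P)
    (hX_L2 : MemLp (X 0) 2 P) (hX_mean : ∫ ω, X 0 ω ∂P = 0)
    (hX_cov : ∀ i j, cov[fun ω => X 0 ω i, fun ω => X 0 ω j; P] = C i j)
    -- the noise: i.i.d., centered, with variance `σ²`, independent of the regressors
    (ε : ℕ → Ω → ℝ)
    (hε_indep : iIndepFun ε P) (hε_ident : ∀ i, IdentDistrib (ε i) (ε 0) P P)
    (hε_L2 : MemLp (ε 0) 2 P) (hε_mean : ∫ ω, ε 0 ω ∂P = 0) (hε_var : Var[ε 0; P] = σ ^ 2)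
    (hXε : IndepFun (fun ω i => X i ω) (fun ω i => ε i ω) P)
    -- the penalties; the limit `lam` is then itself nonnegative and nonincreasing
    (lamSeq : ℕ → Fin p → ℝ) (lam : Fin p → ℝ) (hlamSeq : ∀ n, Slope.IsPenalty (lamSeq n))
    (hlam : Tendsto (fun n : ℕ => (√(n : ℝ))⁻¹ • lamSeq n) atTop (𝓝 lam))
    (hC : C.PosDef)
    -- the SLOPE estimators
    (βhat : ℕ → Ω → EuclideanSpace ℝ (Fin p)) (hβ_meas : ∀ n, AEMeasurable (βhat n) P)
    (hβ_min : ∀ n, ∀ᵐ ω ∂P, IsMinOn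
      (Slope.slopeObjective (Slope.designMatrix (fun i => X i ω) n)
        (Slope.response (fun i => X i ω) (fun i => ε i ω) β₀ n) (lamSeq n))
      Set.univ (βhat n ω))
    -- the Gaussian limit vector
    (W : Ω' → EuclideanSpace ℝ (Fin p))
    (hW : HasLaw W (multivariateGaussian 0 (σ ^ 2 • C)) P') :
    -- the minimizer of the limiting objective exists and is unique
    (∀ w, ∃! u, IsMinOn (Slope.limitObjective C lam β₀ w) Set.univ u) ∧
    -- convergence in distribution to this minimizer
    (∀ uhat : Ω' → EuclideanSpace ℝ (Fin p),
      (∀ᵐ ω ∂P', IsMinOn (Slope.limitObjective C lam β₀ (W ω)) Set.univ (uhat ω)) →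
      TendstoInDistribution (fun (n : ℕ) ω => √(n : ℝ) • (βhat n ω - β₀)) atTop uhat
        (fun _ => P) P') ∧
    -- the directional derivative of the SLOPE norm and its explicit form
    (∀ u, ∃ π, Slope.EventuallySorts π β₀ u) ∧
    (∀ u, Slope.HasDirDeriv (Slope.slopeNorm lam) β₀ u
      (Slope.dirDeriv (Slope.slopeNorm lam) β₀ u)) ∧
    (∀ u π, Slope.EventuallySorts π β₀ u →
      Slope.dirDeriv (Slope.slopeNorm lam) β₀ u =
        ∑ i, lam (π i) * (u i * Real.sign (β₀ i) * (if β₀ i ≠ 0 then 1 else 0)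
          + |u i| * (if β₀ i = 0 then 1 else 0))) := by
  have hlam_pen : Slope.IsPenalty lam := by
    have h := fun i => tendsto_pi_nhds.mp hlam i
    refine ⟨fun i j hij => le_of_tendsto_of_tendsto' (h j) (h i) fun n => ?_,
      fun i => ge_of_tendsto' (h i) fun n => ?_⟩
    · exact mul_le_mul_of_nonneg_left ((hlamSeq n).1 hij) (by positivity)
    · exact mul_nonneg (by positivity) ((hlamSeq n).2 i)
  have hf := Slope.convexOn_dirDeriv_slopeNorm hlam_pen β₀
  obtain ⟨m, hm, hCm⟩ := Slope.exists_pos_le_quadForm hC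
  have hex : ∀ w, ∃! u, IsMinOn (Slope.limitObjective C lam β₀ w) Set.univ u :=
    Slope.existsUnique_isMinOn_quadObjective hf hm hCm (Slope.abs_dirDeriv_slopeNorm_le lam β₀)
  refine ⟨hex, fun uhat huhat => ?_, Slope.exists_eventuallySorts β₀,
    Slope.hasDirDeriv_slopeNorm lam β₀,
    fun u π hπ => Slope.dirDeriv_slopeNorm_eq_of_eventuallySorts lam hπ⟩
  choose umin humin _ using hex
  have hX2 := Slope.integral_mul_of_covariance_eq hX_L2 hX_mean hX_cov
  have hscore := Slope.tendstoInDistribution_score hX_indep hX_ident hX_L2 hX2 hε_indep hε_ident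
    hε_L2 hε_mean hε_var hXε hC.posSemidef hW
  have hX_meas := fun k => (hX_ident k).aemeasurable_fst
  have hgram : TendstoInMeasure P
      (fun n ω => ∑ i, ∑ j, |Slope.empiricalGram (fun k => X k ω) n i j - C i j|) atTop
      fun _ => 0 := by
    refine tendstoInMeasure_of_tendsto_ae (fun n => AEMeasurable.aestronglyMeasurable ?_)
      (Slope.ae_tendsto_empiricalGram hX_indep hX_ident hX_L2 hX2)
    simp only [Slope.empiricalGram, Matrix.of_apply]
    fun_prop
  refine (Slope.tendstoInDistribution_of_isMinOn_quadObjective hf hm hCm humin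
    (fun n => Slope.convexOn_slopeIncrement (hlamSeq n) β₀ (√(n : ℝ))⁻¹)
    (fun R η hη => Slope.eventually_abs_slopeIncrement_sub_le hlam β₀ R hη)
    (fun n ω => Slope.quadForm_empiricalGram_nonneg (fun k => X k ω) n) hgram hscore
    (v := fun n ω => √(n : ℝ) • (βhat n ω - β₀))
    (fun n => ((hβ_meas n).sub_const β₀).const_smul (√(n : ℝ))) ?_).congr
    (fun n => EventuallyEq.rfl) ?_
  · filter_upwards [eventually_gt_atTop 0] with n hn
    filter_upwards [hβ_min n] with ω hω
    exact Slope.isMinOn_quadObjective_of_isMinOn_slopeObjective hn hω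
  -- By uniqueness, any almost sure minimizer `uhat` coincides almost surely with `umin ∘ W`.
  · filter_upwards [huhat] with ω hω
    exact (Slope.existsUnique_isMinOn_quadObjective hf hm hCm
      (Slope.abs_dirDeriv_slopeNorm_le lam β₀) (W ω)).unique (humin (W ω)) hω
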